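/- Let $k\ge 0$ be an integer, let $m=2k+1$, and let $\beta=\mathcal{G}(m)$, where the generalized golden ratio is $\mathcal{G}(m)=\frac{k+1+\sqrt{k^{2}+6k+5}}{2}$ for odd $m=2k+1$. A $\beta$-expansion of a real number $x$ is a sequence $(\varepsilon_i)_{i\ge 1}\in\{0,1,\dots,m\}^{\infty}$ with $x=\sum_{i=1}^{\infty}\varepsilon_i\beta^{-i}$. Then $\frac{m}{\beta-1}=\beta-k$. Let $$\mathcal{S}=\Big\{\frac{p\beta+q}{(k+1)^{n}}\in\Big(0,\frac{m}{\beta-1}\Big): n,p,q\in\mathbb{Z}\Big\}.$$ Every element of $\mathcal{S}$ has countably many $\beta$-expansions, namely exactly $\aleph_0$ of them, while every other element of $(0,\beta-k)$ has uncountably many $\beta$-expansions, namely exactly $2^{\aleph_0}$ of them. -/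

import Mathlib

/-- The set of `β`-expansions of `x` with digits `0, 1, …, m`: all digit sequences
`(ε₁, ε₂, …)` with `x = ∑_{i ≥ 1} ε_i / β ^ i`. The entry `ε i` is the digit `ε_{i+1}`. -/
def betaExpansions (β : ℝ) (m : ℕ) (x : ℝ) : Set (ℕ → Fin (m + 1)) :=
  {ε | HasSum (fun i : ℕ => ((ε i : ℕ) : ℝ) / β ^ (i + 1)) x}

/-- The generalized golden ratio `𝒢(m)`: it is `k + 1` if `m = 2k`, and
`(k + 1 + √(k² + 6k + 5)) / 2` if `m = 2k + 1`. Here `m / 2 : ℕ` is `k` in both cases. -/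
noncomputable def generalizedGoldenRatio (m : ℕ) : ℝ :=
  let k : ℝ := ((m / 2 : ℕ) : ℝ)
  if Even m then k + 1 else (k + 1 + Real.sqrt (k ^ 2 + 6 * k + 5)) / 2

/-- The points of the form `(p β + q) / (k + 1) ^ n`, with `n, p, q ∈ ℤ`, that lie in the open
interval `(0, m / (β - 1))`, where `m = 2k + 1` and `β = 𝒢(m)`. -/
def countableExpansionPoints (k : ℕ) : Set ℝ :=
  {x | x ∈ Set.Ioo (0 : ℝ)
        (((2 * k + 1 : ℕ) : ℝ) / (generalizedGoldenRatio (2 * k + 1) - 1)) ∧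
      ∃ n p q : ℤ,
        x = ((p : ℝ) * generalizedGoldenRatio (2 * k + 1) + (q : ℝ)) / ((k : ℝ) + 1) ^ n}

open Filter Topology

/-! ### Remainders of digit sequences -/

/-! Expansions of x are the digit sequences whose remainders under y ↦ βy - j never leave [0, β-k],
where β² = (k+1)(β+1). Branching: an orbit in the open interval cannot have a forced digit at every
step (`not_forall_isOnlyDigit`). It must meet the zone [β-k-1, 1], where digits k and k+1 both work,
or branch before. An expansion with interior remainders is thus an accumulation point of the
expansion set. Outside 𝒮 no remainder hits an endpoint, so the closed set of expansions is perfect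
and has cardinality 2^ℵ₀. In 𝒮 one interior orbit already gives infinitely many expansions.
Countability: for x in 𝒮 the remainders eventually lie in ℤ[β]. The digit maps contract the
conjugate, since the conjugate k+1-β of β lies in (-1, 0), so remainders end in a finite set. There
a rank never increases (`IsRecurrentPoint.rank_step`), which forces the digits to be eventually
2-periodic. -/

/-- The `n`-th remainder of `x` along the digit sequence `ε` in base `β`. -/
def digitRemainder {m : ℕ} (β : ℝ) (ε : ℕ → Fin (m + 1)) (x : ℝ) : ℕ → ℝ
  | 0 => x
  | n + 1 => β * digitRemainder β ε x n - ((ε n : ℕ) : ℝ)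

theorem digitRemainder_add {m : ℕ} (β : ℝ) (ε : ℕ → Fin (m + 1)) (x : ℝ) (n i : ℕ) :
    digitRemainder β ε x (n + i) =
      digitRemainder β (fun l => ε (n + l)) (digitRemainder β ε x n) i := by
  induction i with
  | zero => rfl
  | succ i ih => rw [← Nat.add_assoc, digitRemainder, digitRemainder, ih]

theorem digitRemainder_congr {m : ℕ} {β : ℝ} {ε δ : ℕ → Fin (m + 1)} {x : ℝ} {n : ℕ}
    (h : ∀ i < n, δ i = ε i) : digitRemainder β δ x n = digitRemainder β ε x n := by
  induction n with
  | zero => rfl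
  | succ n ih =>
    rw [digitRemainder, digitRemainder, ih fun i hi => h i (by omega), h n (by omega)]

theorem continuous_digitRemainder {m : ℕ} (β x : ℝ) (n : ℕ) :
    Continuous fun ε : ℕ → Fin (m + 1) => digitRemainder β ε x n := by
  induction n with
  | zero => exact continuous_const
  | succ n ih =>
    have h : Continuous fun j : Fin (m + 1) => ((j : ℕ) : ℝ) := continuous_of_discreteTopology
    exact (continuous_const.mul ih).sub (h.comp (continuous_apply n))

theorem sum_digits_eq {m : ℕ} {β : ℝ} (hβ : β ≠ 0) (ε : ℕ → Fin (m + 1)) (x : ℝ) (n : ℕ) :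
    ∑ i ∈ Finset.range n, ((ε i : ℕ) : ℝ) / β ^ (i + 1) = x - digitRemainder β ε x n / β ^ n := by
  induction n with
  | zero => simp [digitRemainder]
  | succ n ih =>
    rw [Finset.sum_range_succ, ih, digitRemainder]
    field_simp
    ring

theorem sum_const_div_pow {β : ℝ} (hβ : 1 < β) (c : ℝ) (n : ℕ) :
    ∑ i ∈ Finset.range n, c / β ^ (i + 1) = c / (β - 1) - c / (β - 1) / β ^ n := by
  have hβ0 : β ≠ 0 := by linarith
  have hβ1 : β - 1 ≠ 0 := by linarith
  induction n with
  | zero => simp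
  | succ n ih =>
    rw [Finset.sum_range_succ, ih]
    field_simp
    ring

/-- Comparison with the constant digits 0 and m bounds the tails; conversely, bounded remainders
divided by β^n tend to 0. -/
theorem mem_betaExpansions_iff {m : ℕ} {β : ℝ} (hβ : 1 < β) {x : ℝ} {ε : ℕ → Fin (m + 1)} :
    ε ∈ betaExpansions β m x ↔ ∀ n, digitRemainder β ε x n ∈ Set.Icc 0 ((m : ℝ) / (β - 1)) := by
  have hβ0 : 0 < β := by linarith
  have hβ1 : 0 < β - 1 := by linarith
  have hnn : ∀ i, 0 ≤ ((ε i : ℕ) : ℝ) / β ^ (i + 1) := fun i => by positivity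
  constructor
  · intro h n
    have hp : 0 < β ^ n := by positivity
    have h1 := sum_le_hasSum (Finset.range n) (fun i _ => hnn i) h
    rw [sum_digits_eq hβ0.ne' ε x] at h1
    have hgeom : HasSum (fun i : ℕ => (m : ℝ) / β ^ (i + 1)) ((m : ℝ) / (β - 1)) := by
      have h2 := (hasSum_geometric_of_lt_one (r := β⁻¹) (by positivity)
        (inv_lt_one_of_one_lt₀ hβ)).mul_left ((m : ℝ) / β)
      have e : (m : ℝ) / (β - 1) = (m : ℝ) / β * (1 - β⁻¹)⁻¹ := by
        have : 1 - β⁻¹ = (β - 1) / β := by field_simp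
        rw [this]
        field_simp
      rw [e]
      refine h2.congr_fun ?_
      intro i
      rw [pow_succ, inv_pow]
      field_simp
    have hc := hgeom.sub h
    have h3 := sum_le_hasSum (Finset.range n) (fun i _ => ?_) hc
    · rw [Finset.sum_sub_distrib, sum_digits_eq hβ0.ne' ε x, sum_const_div_pow hβ] at h3
      have h4 : 0 ≤ digitRemainder β ε x n / β ^ n := by linarith
      refine ⟨by simpa [div_mul_cancel₀ _ hp.ne'] using mul_nonneg h4 hp.le, ?_⟩
      rw [← div_le_div_iff_of_pos_right hp]
      linarith
    · have h4 : ((ε i : ℕ) : ℝ) ≤ m := by exact_mod_cast Nat.lt_succ_iff.1 (ε i).2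
      rw [sub_nonneg]
      gcongr
  · intro h
    rw [betaExpansions, Set.mem_ofPred_eq, hasSum_iff_tendsto_nat_of_nonneg hnn]
    have ht : Tendsto (fun n => digitRemainder β ε x n / β ^ n) atTop (𝓝 0) := by
      have h1 : Tendsto (fun n : ℕ => ((m : ℝ) / (β - 1)) / β ^ n) atTop (𝓝 0) :=
        tendsto_const_nhds.div_atTop (tendsto_pow_atTop_atTop_of_one_lt hβ)
      refine squeeze_zero (fun n => div_nonneg (h n).1 (by positivity)) (fun n => ?_) h1
      exact div_le_div_of_nonneg_right (h n).2 (by positivity)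
    have := (tendsto_const_nhds (x := x)).sub ht
    simpa only [sum_digits_eq hβ0.ne' ε x, sub_zero] using this

/-! ### The quadratic base -/

/-- `β` is the positive root of `β² = (k + 1) (β + 1)`. -/
structure IsQuadraticBase (k : ℕ) (β : ℝ) : Prop where
  pos : 0 < β
  sq : β ^ 2 = ((k : ℝ) + 1) * (β + 1)

namespace IsQuadraticBase

variable {k : ℕ} {β : ℝ}

theorem lt_base (h : IsQuadraticBase k β) : (k : ℝ) + 1 < β := by
  have h1 := h.pos
  have h2 := h.sq
  have h3 : (0 : ℝ) ≤ k := k.cast_nonneg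
  nlinarith

theorem base_lt (h : IsQuadraticBase k β) : β < (k : ℝ) + 2 := by
  have h1 := h.pos
  have h2 := h.sq
  have h3 : (0 : ℝ) ≤ k := k.cast_nonneg
  nlinarith

theorem one_lt (h : IsQuadraticBase k β) : 1 < β := by
  have := h.lt_base
  have h3 : (0 : ℝ) ≤ k := k.cast_nonneg
  linarith

theorem div_eq (h : IsQuadraticBase k β) : ((2 * k + 1 : ℕ) : ℝ) / (β - 1) = β - k := by
  have h1 := h.one_lt
  have h2 := h.sq
  rw [div_eq_iff (by linarith)]
  push_cast
  linarith

theorem mem_betaExpansions_iff (h : IsQuadraticBase k β) {x : ℝ} {ε : ℕ → Fin (2 * k + 1 + 1)} :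
    ε ∈ betaExpansions β (2 * k + 1) x ↔ ∀ n, digitRemainder β ε x n ∈ Set.Icc 0 (β - k) := by
  rw [_root_.mem_betaExpansions_iff h.one_lt, h.div_eq]

theorem isClosed_betaExpansions (h : IsQuadraticBase k β) (x : ℝ) :
    IsClosed (betaExpansions β (2 * k + 1) x) := by
  have : betaExpansions β (2 * k + 1) x =
      ⋂ n, (fun ε => digitRemainder β ε x n) ⁻¹' Set.Icc 0 (β - k) := by
    ext ε
    simp only [h.mem_betaExpansions_iff, Set.mem_iInter, Set.mem_preimage]
  rw [this]
  exact isClosed_iInter fun n => isClosed_Icc.preimage (continuous_digitRemainder β x n)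

theorem exists_digit_mem_Ioo (h : IsQuadraticBase k β) {y : ℝ} (hy : y ∈ Set.Ioo 0 (β - k)) :
    ∃ j : Fin (2 * k + 1 + 1), β * y - ((j : ℕ) : ℝ) ∈ Set.Ioo 0 (β - k) := by
  have h1 := h.lt_base
  have h2 := h.sq
  have hpos : 0 < β * y := mul_pos h.pos hy.1
  rcases lt_or_ge ((2 * k + 1 : ℕ) : ℝ) (β * y) with hlt | hle
  · refine ⟨Fin.last _, ?_⟩
    have := mul_lt_mul_of_pos_left hy.2 h.pos
    rw [Fin.val_last]
    refine ⟨by linarith, ?_⟩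
    push_cast
    nlinarith
  -- The digit ⌈βy⌉ - 1 leaves a remainder in (0, 1], and 1 < β-k.
  · have hc : 0 < ⌈β * y⌉₊ := Nat.ceil_pos.2 hpos
    have hc' : ⌈β * y⌉₊ ≤ 2 * k + 1 := Nat.ceil_le.2 hle
    refine ⟨⟨⌈β * y⌉₊ - 1, by omega⟩, ?_⟩
    have e : ((⌈β * y⌉₊ - 1 : ℕ) : ℝ) = (⌈β * y⌉₊ : ℝ) - 1 := by
      rw [Nat.cast_sub hc, Nat.cast_one]
    have h3 := Nat.le_ceil (β * y)
    have h4 := Nat.ceil_lt_add_one hpos.le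
    simp only [e]
    constructor <;> linarith

theorem exists_forall_digitRemainder_mem_Ioo (h : IsQuadraticBase k β) {x : ℝ}
    (hx : x ∈ Set.Ioo 0 (β - k)) :
    ∃ ε : ℕ → Fin (2 * k + 1 + 1), ∀ n, digitRemainder β ε x n ∈ Set.Ioo 0 (β - k) := by
  choose d hd using fun y : Set.Ioo 0 (β - k) => h.exists_digit_mem_Ioo y.2
  let r : ℕ → Set.Ioo 0 (β - k) := fun n =>
    Nat.rec ⟨x, hx⟩ (fun _ y => ⟨β * y - ((d y : ℕ) : ℝ), hd y⟩) n
  refine ⟨fun n => d (r n), fun n => ?_⟩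
  have : digitRemainder β (fun n => d (r n)) x n = (r n).1 := by
    induction n with
    | zero => rfl
    | succ n ih => rw [digitRemainder, ih]
  rw [this]
  exact (r n).2

theorem betaExpansions_nonempty (h : IsQuadraticBase k β) {x : ℝ}
    (hx : x ∈ Set.Icc 0 (β - k)) : (betaExpansions β (2 * k + 1) x).Nonempty := by
  have h1 := h.lt_base
  rcases eq_or_lt_of_le hx.1 with rfl | h0
  · refine ⟨fun _ => 0, h.mem_betaExpansions_iff.2 fun n => ?_⟩
    have : digitRemainder β (fun _ => (0 : Fin (2 * k + 1 + 1))) 0 n = 0 := by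
      induction n with
      | zero => rfl
      | succ n ih => simp [digitRemainder, ih]
    rw [this]
    exact hx
  rcases eq_or_lt_of_le hx.2 with rfl | hL
  · refine ⟨fun _ => Fin.last _, h.mem_betaExpansions_iff.2 fun n => ?_⟩
    have : digitRemainder β (fun _ => Fin.last (2 * k + 1)) (β - k) n = β - k := by
      induction n with
      | zero => rfl
      | succ n ih =>
        rw [digitRemainder, ih, Fin.val_last]
        push_cast
        linarith [h.sq]
    rw [this]
    exact hx
  · obtain ⟨ε, hε⟩ := h.exists_forall_digitRemainder_mem_Ioo ⟨h0, hL⟩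
    exact ⟨ε, h.mem_betaExpansions_iff.2 fun n => Set.Ioo_subset_Icc_self (hε n)⟩

/-! ### Interior orbits always branch -/

/-- The digit `j` is the only one leading from `y` to a point of `[0, β - k]`. -/
def IsOnlyDigit (k : ℕ) (β y : ℝ) (j : Fin (2 * k + 1 + 1)) : Prop :=
  ∀ i : Fin (2 * k + 1 + 1), i ≠ j → β * y - ((i : ℕ) : ℝ) ∉ Set.Icc 0 (β - k)

theorem IsOnlyDigit.eq_of_le {y : ℝ} {j : Fin (2 * k + 1 + 1)} (hj : IsOnlyDigit k β y j)
    (i : ℕ) (hi : i ≤ 2 * k + 1) (h0 : (i : ℝ) ≤ β * y) (h1 : β * y ≤ i + (β - k)) :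
    i = j := by
  by_contra hne
  exact hj ⟨i, by omega⟩ (fun e => hne (congrArg Fin.val e)) ⟨by simpa using h0, by
    simp only
    linarith⟩

/-- Since β(β-k-1) = k+1, here βy lies in [k+1, β], where digits k and k+1 are both admissible. -/
theorem notMem_Icc_of_isOnlyDigit (h : IsQuadraticBase k β) {y : ℝ} {j : Fin (2 * k + 1 + 1)}
    (hj : IsOnlyDigit k β y j) : y ∉ Set.Icc (β - k - 1) 1 := by
  rintro ⟨h0, h1⟩
  have h2 := h.sq
  have h3 := h.lt_base
  have h4 := mul_le_mul_of_nonneg_left h0 h.pos.le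
  have h5 := mul_le_mul_of_nonneg_left h1 h.pos.le
  have e1 := hj.eq_of_le k (by omega) (by nlinarith) (by linarith)
  have e2 := hj.eq_of_le (k + 1) (by omega) (by push_cast; nlinarith) (by push_cast; linarith)
  omega

theorem lower_step (h : IsQuadraticBase k β) {y : ℝ} {j j' : Fin (2 * k + 1 + 1)}
    (hj : IsOnlyDigit k β y j) (hlt : y < β - k - 1)
    (hz : β * y - ((j : ℕ) : ℝ) ∈ Set.Ioo 0 (β - k))
    (hj' : IsOnlyDigit k β (β * y - ((j : ℕ) : ℝ)) j') :
    β * y - ((j : ℕ) : ℝ) = β * y ∧ β * y < β - k - 1 := by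
  obtain ⟨hz0, hz1⟩ := hz
  have h2 := h.sq
  have h3 := h.lt_base
  have h4 := mul_lt_mul_of_pos_left hlt h.pos
  have hk : ((j : ℕ) : ℝ) < ((k + 1 : ℕ) : ℝ) := by
    push_cast
    nlinarith
  have hk' : (j : ℕ) < k + 1 := by exact_mod_cast hk
  have hnot := h.notMem_Icc_of_isOnlyDigit hj'
  have hup : β * y - ((j : ℕ) : ℝ) < 1 := by
    by_contra hcon
    have := hj.eq_of_le (j + 1) (by omega) (by push_cast; linarith) (by push_cast; linarith)
    omega
  have hlow : β * y - ((j : ℕ) : ℝ) < β - k - 1 := by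
    by_contra hcon
    exact hnot ⟨by linarith, hup.le⟩
  have hj0 : (j : ℕ) = 0 := by
    by_contra hne
    have e : (((j : ℕ) - 1 : ℕ) : ℝ) = ((j : ℕ) : ℝ) - 1 := by
      rw [Nat.cast_sub (by omega), Nat.cast_one]
    have := hj.eq_of_le (j - 1) (by omega) (by rw [e]; linarith) (by rw [e]; linarith)
    omega
  rw [hj0] at hlow ⊢
  simp only [Nat.cast_zero, sub_zero] at hlow ⊢
  exact ⟨trivial, hlow⟩

/-- The symmetry y ↦ β-k-y, j ↦ 2k+1-j reduces orbits above the branching zone to orbits below it.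
-/
theorem reflect_eq (h : IsQuadraticBase k β) (y : ℝ) (j : Fin (2 * k + 1 + 1)) :
    β * (β - k - y) - ((j.rev : ℕ) : ℝ) = β - k - (β * y - ((j : ℕ) : ℝ)) := by
  have e : ((j.rev : ℕ) : ℝ) = 2 * k + 1 - ((j : ℕ) : ℝ) := by
    rw [Fin.val_rev, Nat.cast_sub (by omega)]
    push_cast
    ring
  rw [e]
  linarith [h.sq]

theorem IsOnlyDigit.reflect (h : IsQuadraticBase k β) {y : ℝ} {j : Fin (2 * k + 1 + 1)}
    (hj : IsOnlyDigit k β y j) : IsOnlyDigit k β (β - k - y) j.rev := by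
  intro i hi hmem
  refine hj i.rev (fun e => hi (by rw [← e, Fin.rev_rev])) ?_
  have := h.reflect_eq y i.rev
  rw [Fin.rev_rev] at this
  rw [this] at hmem
  exact ⟨by linarith [hmem.2], by linarith [hmem.1]⟩

theorem not_forall_isOnlyDigit_of_lt (h : IsQuadraticBase k β) {y : ℝ}
    {ε : ℕ → Fin (2 * k + 1 + 1)} (hlt : y < β - k - 1)
    (hr : ∀ n, digitRemainder β ε y n ∈ Set.Ioo 0 (β - k))
    (hu : ∀ n, IsOnlyDigit k β (digitRemainder β ε y n) (ε n)) : False := by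
  have key : ∀ n, digitRemainder β ε y n = β ^ n * y ∧ digitRemainder β ε y n < β - k - 1 := by
    intro n
    induction n with
    | zero => simpa [digitRemainder] using hlt
    | succ n ih =>
      have hs := h.lower_step (hu n) ih.2 (hr (n + 1)) (hu (n + 1))
      rw [digitRemainder, hs.1]
      refine ⟨?_, hs.2⟩
      rw [ih.1]
      ring
  have hy : 0 < y := (hr 0).1
  obtain ⟨n, hn⟩ := pow_unbounded_of_one_lt (1 / y) h.one_lt
  rw [div_lt_iff₀ hy, ← (key n).1] at hn
  linarith [(key n).2, h.base_lt]

theorem digitRemainder_reflect (h : IsQuadraticBase k β) (y : ℝ) (ε : ℕ → Fin (2 * k + 1 + 1))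
    (n : ℕ) :
    digitRemainder β (fun i => (ε i).rev) (β - k - y) n = β - k - digitRemainder β ε y n := by
  induction n with
  | zero => rfl
  | succ n ih => rw [digitRemainder, ih, h.reflect_eq, digitRemainder]

theorem not_forall_isOnlyDigit (h : IsQuadraticBase k β) {y : ℝ} {ε : ℕ → Fin (2 * k + 1 + 1)}
    (hr : ∀ n, digitRemainder β ε y n ∈ Set.Ioo 0 (β - k))
    (hu : ∀ n, IsOnlyDigit k β (digitRemainder β ε y n) (ε n)) : False := by
  have hnot : y ∉ Set.Icc (β - k - 1) 1 := h.notMem_Icc_of_isOnlyDigit (hu 0)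
  rcases lt_or_ge y (β - k - 1) with hlt | hge
  · exact h.not_forall_isOnlyDigit_of_lt hlt hr hu
  · have h1 : 1 < y := by
      by_contra hcon
      exact hnot ⟨hge, not_lt.1 hcon⟩
    refine h.not_forall_isOnlyDigit_of_lt (y := β - k - y) (ε := fun i => (ε i).rev)
      (by linarith) (fun n => ?_) fun n => ?_
    · rw [h.digitRemainder_reflect]
      exact ⟨by linarith [(hr n).2], by linarith [(hr n).1]⟩
    · rw [h.digitRemainder_reflect]
      exact (hu n).reflect h

theorem exists_ne_of_forall_mem_Ioo (h : IsQuadraticBase k β) {x : ℝ}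
    {ε : ℕ → Fin (2 * k + 1 + 1)} (hr : ∀ n, digitRemainder β ε x n ∈ Set.Ioo 0 (β - k)) (N : ℕ) :
    ∃ δ ∈ betaExpansions β (2 * k + 1) x, (∀ i < N, δ i = ε i) ∧ δ ≠ ε := by
  obtain ⟨n, hn⟩ : ∃ n, ¬ IsOnlyDigit k β (digitRemainder β ε x (N + n)) (ε (N + n)) := by
    by_contra! hcon
    refine h.not_forall_isOnlyDigit (y := digitRemainder β ε x N) (ε := fun l => ε (N + l))
      (fun n => ?_) fun n => ?_
    · rw [← digitRemainder_add]
      exact hr _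
    · rw [← digitRemainder_add]
      exact hcon n
  simp only [IsOnlyDigit, not_forall, not_not] at hn
  obtain ⟨j, hj, hmem⟩ := hn
  set M := N + n with hM
  obtain ⟨η, hη⟩ := h.betaExpansions_nonempty hmem
  rw [h.mem_betaExpansions_iff] at hη
  let δ : ℕ → Fin (2 * k + 1 + 1) := fun i =>
    if i < M then ε i else if i = M then j else η (i - (M + 1))
  have hlt : ∀ i < M, δ i = ε i := fun i hi => if_pos hi
  have heq : δ M = j := by simp [δ]
  have hle : ∀ i ≤ M, digitRemainder β δ x i = digitRemainder β ε x i := fun i hi =>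
    digitRemainder_congr fun l hl => hlt l (by omega)
  refine ⟨δ, h.mem_betaExpansions_iff.2 fun i => ?_, fun i hi => hlt i (by omega),
    fun e => hj (by rw [← heq, e])⟩
  rcases le_or_gt i M with hi | hi
  · rw [hle i hi]
    exact Set.Ioo_subset_Icc_self (hr i)
  · obtain ⟨l, rfl⟩ := Nat.exists_eq_add_of_le (Nat.succ_le_of_lt hi)
    have hs : (fun l => δ (M.succ + l)) = η := by
      funext l
      have h1 : ¬ M.succ + l < M := by omega
      have h2 : M.succ + l ≠ M := by omega
      simp only [δ, if_neg h1, if_neg h2]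
      congr 1
      omega
    rw [digitRemainder_add, hs, digitRemainder, hle M le_rfl, heq]
    exact hη l

/-! ### Accumulation points and cardinality -/

theorem accPt_betaExpansions (h : IsQuadraticBase k β) {x : ℝ}
    {ε : ℕ → Fin (2 * k + 1 + 1)} (hr : ∀ n, digitRemainder β ε x n ∈ Set.Ioo 0 (β - k)) :
    AccPt ε (𝓟 (betaExpansions β (2 * k + 1) x)) := by
  rw [accPt_iff_nhds]
  intro U hU
  obtain ⟨V, ⟨η, N, rfl⟩, hεV, hVU⟩ :=
    (PiNat.isTopologicalBasis_cylinders fun _ : ℕ => Fin (2 * k + 1 + 1)).mem_nhds_iff.1 hU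
  obtain ⟨δ, hδ, hagree, hne⟩ := h.exists_ne_of_forall_mem_Ioo hr N
  refine ⟨δ, ⟨hVU ?_, hδ⟩, hne⟩
  rw [← PiNat.mem_cylinder_iff_eq.1 hεV]
  exact PiNat.mem_cylinder_iff.2 hagree

theorem infinite_betaExpansions (h : IsQuadraticBase k β) {x : ℝ}
    (hx : x ∈ Set.Ioo 0 (β - k)) : (betaExpansions β (2 * k + 1) x).Infinite := by
  obtain ⟨ε, hε⟩ := h.exists_forall_digitRemainder_mem_Ioo hx
  exact Set.Infinite.of_accPt (h.accPt_betaExpansions hε)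

theorem mk_betaExpansions_eq_continuum (h : IsQuadraticBase k β) {x : ℝ}
    (hx : x ∈ Set.Ioo 0 (β - k))
    (hr : ∀ ε ∈ betaExpansions β (2 * k + 1) x, ∀ n,
      digitRemainder β ε x n ∈ Set.Ioo 0 (β - k)) :
    Cardinal.mk (betaExpansions β (2 * k + 1) x) = Cardinal.continuum := by
  apply le_antisymm
  · refine (Cardinal.mk_set_le _).trans ?_
    have := Cardinal.nat_power_aleph0 (n := 2 * k + 1 + 1) (by omega)
    rw [← this]
    simp
  · have hperf : Perfect (betaExpansions β (2 * k + 1) x) :=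
      ⟨h.isClosed_betaExpansions x, fun ε hε => h.accPt_betaExpansions (hr ε hε)⟩
    let := TopologicalSpace.upgradeIsCompletelyMetrizable (ℕ → Fin (2 * k + 1 + 1))
    obtain ⟨f, hf, -, hinj⟩ := hperf.exists_nat_bool_injection
      (h.betaExpansions_nonempty (Set.Ioo_subset_Icc_self hx))
    have := Cardinal.mk_le_of_injective
      (f := fun b => (⟨f b, hf ⟨b, rfl⟩⟩ : betaExpansions β (2 * k + 1) x))
      fun a b hab => hinj (congrArg Subtype.val hab)
    simpa using this

end IsQuadraticBase

/-! ### Eventually `2`-periodic sequences -/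

theorem countable_setOf_eventually_periodic_two (α : Type*) [Countable α] :
    {ε : ℕ → α | ∃ N, ∀ n ≥ N, ε (n + 2) = ε n}.Countable := by
  have hsub : {ε : ℕ → α | ∃ N, ∀ n ≥ N, ε (n + 2) = ε n} =
      ⋃ N, {ε : ℕ → α | ∀ n ≥ N, ε (n + 2) = ε n} := by
    ext ε
    simp
  rw [hsub]
  refine Set.countable_iUnion fun N => ?_
  let g : (ℕ → α) → (Fin (N + 2) → α) := fun ε i => ε i
  refine Set.MapsTo.countable_of_injOn (f := g) (t := Set.univ) (fun _ _ => trivial) ?_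
    Set.countable_univ
  intro ε hε δ hδ hg
  funext n
  induction n using Nat.strong_induction_on with
  | _ n ih =>
    rcases lt_or_ge n (N + 2) with hn | hn
    · exact congrFun hg ⟨n, hn⟩
    · obtain ⟨l, rfl⟩ := Nat.exists_eq_add_of_le' (show 2 ≤ n by omega)
      rw [hε l (by omega), hδ l (by omega)]
      exact ih l (by omega)

/-! ### Lattice points and their conjugates -/

/-- The coordinates of `β y - j` when `y = A + B (k + 2 - β)` has coordinates `(A, B)`. -/
def latticeStep (k : ℕ) (P : ℤ × ℤ) (j : ℕ) : ℤ × ℤ :=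
  ((k + 2) * P.1 + P.2 - j, -P.1 - P.2)

/-- A rank on the recurrent lattice points that does not increase along orbits. -/
def latticeRank (P : ℤ × ℤ) : ℕ :=
  if P.1 = 1 then (max (2 * P.2 + 1) (-2 * P.2 - 1)).toNat
  else if P.1 = 0 then (2 * P.2).toNat else (-2 - 2 * P.2).toNat

/-- The lattice points which are recurrent for the digit maps. -/
def IsRecurrentPoint (k : ℕ) (P : ℤ × ℤ) : Prop :=
  (P.1 = 0 ∧ 0 ≤ P.2 ∧ P.2 ≤ k) ∨ (P.1 = 1 ∧ -(k + 1) ≤ P.2 ∧ P.2 ≤ k) ∨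
    (P.1 = 2 ∧ -(k + 1) ≤ P.2 ∧ P.2 ≤ -1)

/-- On recurrent points (A, B) the rank is |A + 2B|. A step sends B to -A-B, which preserves this
when A is unchanged; the bounds on B and j make it drop when A changes. -/
theorem IsRecurrentPoint.rank_step {k : ℕ} {P : ℤ × ℤ} {j : ℕ} (hj : j ≤ 2 * k + 1)
    (hP : IsRecurrentPoint k P) (hQ : IsRecurrentPoint k (latticeStep k P j)) :
    latticeRank (latticeStep k P j) < latticeRank P ∨
      latticeRank (latticeStep k P j) = latticeRank P ∧ (latticeStep k P j).1 = P.1 := by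
  obtain ⟨A, B⟩ := P
  simp only [IsRecurrentPoint, latticeStep, latticeRank] at *
  rcases hP with ⟨rfl, h1, h2⟩ | ⟨rfl, h1, h2⟩ | ⟨rfl, h1, h2⟩ <;>
  rcases hQ with ⟨e, h3, h4⟩ | ⟨e, h3, h4⟩ | ⟨e, h3, h4⟩ <;>
  simp only [e] <;> norm_num <;> omega

theorem exists_forall_ge_eq_of_antitone_step {f : ℕ → ℕ} {p : ℕ → Prop}
    (h : ∀ n, f (n + 1) < f n ∨ f (n + 1) = f n ∧ p n) : ∃ N, ∀ n ≥ N, p n := by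
  have hanti : Antitone f := antitone_nat_of_succ_le fun n => by
    rcases h n with h | h <;> omega
  obtain ⟨N, hN⟩ : ∃ N, ∀ n, f N ≤ f n := by
    obtain ⟨N, hN⟩ := Set.range_nonempty f |> fun hne => Nat.sInf_mem hne
    exact ⟨N, fun n => hN ▸ Nat.sInf_le ⟨n, rfl⟩⟩
  refine ⟨N, fun n hn => ?_⟩
  rcases h n with h1 | h1
  · have h2 := hanti hn
    have h3 := hN (n + 1)
    omega
  · exact h1.2

/-- The orbit of lattice coordinates along a digit sequence. -/
def latticeOrbit (k : ℕ) (ε : ℕ → ℕ) (P : ℤ × ℤ) : ℕ → ℤ × ℤ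
  | 0 => P
  | n + 1 => latticeStep k (latticeOrbit k ε P n) (ε n)

theorem eventually_periodic_of_isRecurrentPoint {k : ℕ} {ε : ℕ → ℕ} {P : ℤ × ℤ} {N : ℕ}
    (hε : ∀ n, ε n ≤ 2 * k + 1) (h : ∀ n ≥ N, IsRecurrentPoint k (latticeOrbit k ε P n)) :
    ∃ M, ∀ n ≥ M, ε (n + 2) = ε n := by
  obtain ⟨M, hM⟩ := exists_forall_ge_eq_of_antitone_step
    (f := fun n => latticeRank (latticeOrbit k ε P (N + n)))
    (p := fun n => (latticeOrbit k ε P (N + n + 1)).1 = (latticeOrbit k ε P (N + n)).1)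
    fun n => (h (N + n) (by omega)).rank_step (hε (N + n)) (h (N + n + 1) (by omega))
  -- With A constant, B ↦ -A-B is an involution, and the digit is (k+1)A + B.
  refine ⟨N + M, fun n hn => ?_⟩
  obtain ⟨l, rfl⟩ := Nat.exists_eq_add_of_le hn
  have e0 := hM (M + l) (by omega)
  have e1 := hM (M + l + 1) (by omega)
  have e2 := hM (M + l + 2) (by omega)
  rw [show N + (M + l) = N + M + l by ring] at e0
  rw [show N + (M + l + 1) = N + M + l + 1 by ring] at e1
  rw [show N + (M + l + 2) = N + M + l + 2 by ring] at e2
  simp only [latticeOrbit, latticeStep] at e0 e1 e2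
  generalize latticeOrbit k ε P (N + M + l) = Q at *
  obtain ⟨A, B⟩ := Q
  simp only at *
  rw [e0] at e1 e2
  rw [e1] at e2
  omega

/-! ### Contraction of conjugates -/

namespace IsQuadraticBase

variable {k : ℕ} {β : ℝ}

/-- The real number with lattice coordinates `P`. -/
def latticeValue (k : ℕ) (β : ℝ) (P : ℤ × ℤ) : ℝ := P.1 + P.2 * (k + 2 - β)

/-- The algebraic conjugate of the number with lattice coordinates `P`. -/
def latticeConj (β : ℝ) (P : ℤ × ℤ) : ℝ := P.1 + P.2 * (β + 1)

theorem latticeValue_step (h : IsQuadraticBase k β) (P : ℤ × ℤ) (j : ℕ) :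
    latticeValue k β (latticeStep k P j) = β * latticeValue k β P - j := by
  simp only [latticeValue, latticeStep]
  push_cast
  linear_combination ((P.2 : ℝ)) * h.sq

theorem latticeConj_step (h : IsQuadraticBase k β) (P : ℤ × ℤ) (j : ℕ) :
    latticeConj β (latticeStep k P j) = -(β - k - 1) * latticeConj β P - j := by
  simp only [latticeConj, latticeStep]
  push_cast
  linear_combination ((P.2 : ℝ)) * h.sq

/-- The centre -(β-1)/2 is the fixed point of the conjugate map with the mean digit (2k+1)/2. -/
theorem abs_latticeConj_step (h : IsQuadraticBase k β) (P : ℤ × ℤ) {j : ℕ}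
    (hj : j ≤ 2 * k + 1) :
    |latticeConj β (latticeStep k P j) + (β - 1) / 2| ≤
      (β - k - 1) * |latticeConj β P + (β - 1) / 2| + (2 * k + 1) / 2 := by
  have e : latticeConj β (latticeStep k P j) + (β - 1) / 2 =
      -(β - k - 1) * (latticeConj β P + (β - 1) / 2) + ((2 * k + 1) / 2 - j) := by
    rw [h.latticeConj_step]
    linear_combination h.sq / 2
  have hj' : (j : ℝ) ≤ 2 * k + 1 := by exact_mod_cast hj
  have hj0 : (0 : ℝ) ≤ j := j.cast_nonneg
  rw [e]
  refine (abs_add_le _ _).trans (add_le_add ?_ ?_)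
  · rw [abs_mul, abs_neg, abs_of_pos (by linarith [h.lt_base])]
  · rw [abs_le]
    constructor <;> linarith

theorem exists_forall_ge_abs_latticeConj_lt (h : IsQuadraticBase k β) {ε : ℕ → ℕ}
    (hε : ∀ n, ε n ≤ 2 * k + 1) (P : ℤ × ℤ) :
    ∃ N, ∀ n ≥ N, |latticeConj β (latticeOrbit k ε P n) + (β - 1) / 2| <
      (2 * k + 1) * (β + 1) / 2 + 1 := by
  have h0 : 0 < β - k - 1 := by linarith [h.lt_base]
  have h1 : β - k - 1 < 1 := by linarith [h.base_lt]
  set C := |latticeConj β P + (β - 1) / 2|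
  have hb : ∀ n, |latticeConj β (latticeOrbit k ε P n) + (β - 1) / 2| ≤
      (β - k - 1) ^ n * C + (2 * k + 1) * (β + 1) / 2 := by
    intro n
    induction n with
    | zero =>
      have := h.pos
      simp only [latticeOrbit, pow_zero, one_mul]
      have : 0 ≤ (2 * (k : ℝ) + 1) * (β + 1) / 2 := by positivity
      linarith
    | succ n ih =>
      refine (h.abs_latticeConj_step _ (hε n)).trans ?_
      have := mul_le_mul_of_nonneg_left ih h0.le
      -- The radius is the fixed point of r ↦ (β-k-1)r + (2k+1)/2.
      have e : (β - k - 1) * ((2 * k + 1) * (β + 1) / 2) + (2 * k + 1) / 2 =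
          (2 * k + 1) * (β + 1) / 2 := by
        linear_combination (2 * (k : ℝ) + 1) / 2 * h.sq
      rw [pow_succ']
      linarith
  have ht : Tendsto (fun n : ℕ => (β - k - 1) ^ n * C) atTop (𝓝 0) := by
    simpa using (tendsto_pow_atTop_nhds_zero_of_lt_one h0.le h1).mul_const C
  obtain ⟨N, hN⟩ := eventually_atTop.1 (ht.eventually_lt_const one_pos)
  exact ⟨N, fun n hn => by linarith [hb n, hN n hn]⟩

theorem isRecurrentPoint_of_conj_lt (h : IsQuadraticBase k β) {P : ℤ × ℤ}
    (hv : latticeValue k β P ∈ Set.Icc 0 (β - k))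
    (hc : |latticeConj β P + (β - 1) / 2| < (2 * k + 1) * (β + 1) / 2 + 1) :
    IsRecurrentPoint k P := by
  obtain ⟨A, B⟩ := P
  obtain ⟨hv0, hv1⟩ := hv
  obtain ⟨hc0, hc1⟩ := abs_lt.1 hc
  simp only [latticeValue, latticeConj] at hv0 hv1 hc0 hc1
  have h1 := h.lt_base
  have h2 := h.base_lt
  have hsq := h.sq
  have hk : (0 : ℝ) ≤ k := k.cast_nonneg
  -- μ is a unit with inverse β+1, so multiplying the conjugate bounds by μ bounds B + Aμ.
  obtain ⟨μ, rfl⟩ : ∃ μ, β = k + 2 - μ := ⟨k + 2 - β, by ring⟩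
  have hmu : μ ^ 2 = (k + 3) * μ - 1 := by linear_combination hsq
  have hμ0 : 0 < μ := by linarith
  have hμ1 : μ < 1 / 2 := by nlinarith
  have hup : B + A * μ < k + 2 * μ := by
    have := mul_lt_mul_of_pos_left hc1 hμ0
    linear_combination this + (B - k) * hmu
  have hlow : -(k + 1 : ℝ) < B + A * μ := by
    have := mul_lt_mul_of_pos_left hc0 hμ0
    linear_combination this + (-B - (k + 1)) * hmu
  have hx0 : 0 ≤ A + B * μ := by linarith
  have hx1 : A + B * μ ≤ 2 - μ := by linarith
  have hA0 : 0 ≤ A := by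
    by_contra! hcon
    have hA : (A : ℝ) ≤ -1 := by exact_mod_cast Int.le_sub_one_of_lt hcon
    nlinarith [mul_lt_mul_of_pos_left hup hμ0]
  have hA2 : A ≤ 2 := by
    by_contra! hcon
    have hA : (3 : ℝ) ≤ A := by exact_mod_cast hcon
    nlinarith [mul_lt_mul_of_pos_left hlow hμ0]
  simp only [IsRecurrentPoint]
  obtain rfl | rfl | rfl : A = 0 ∨ A = 1 ∨ A = 2 := by omega
  · refine Or.inl ⟨rfl, ?_, ?_⟩
    · have : (0 : ℝ) ≤ B := nonneg_of_mul_nonneg_left (by simpa using hx0) hμ0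
      exact_mod_cast this
    · refine Int.lt_add_one_iff.1 ?_
      have : (B : ℝ) < k + 1 := by
        push_cast at hup
        linarith
      exact_mod_cast this
  · refine Or.inr (Or.inl ⟨rfl, ?_, ?_⟩)
    · have : (-(k + 2) : ℝ) < B := by
        push_cast at hlow
        linarith
      have : (-(k + 2) : ℤ) < B := by exact_mod_cast this
      omega
    · refine Int.lt_add_one_iff.1 ?_
      have : (B : ℝ) < k + 1 := by
        push_cast at hup
        linarith
      exact_mod_cast this
  · refine Or.inr (Or.inr ⟨rfl, ?_, ?_⟩)
    · have : (-(k + 2) : ℝ) < B := by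
        push_cast at hlow
        linarith
      have : (-(k + 2) : ℤ) < B := by exact_mod_cast this
      omega
    · have : (B : ℝ) ≤ -1 := by
        push_cast at hx1
        exact le_of_mul_le_mul_right (by linarith) hμ0
      exact_mod_cast this

/-! ### Numbers of the form `(p β + q) / (k + 1) ^ n` -/

theorem mem_range_latticeValue_mul_add (k : ℕ) (β : ℝ) (p q : ℤ) :
    p * β + q ∈ Set.range (latticeValue k β) := by
  refine ⟨(p * (k + 2) + q, -p), ?_⟩
  simp only [latticeValue]
  push_cast
  ring

theorem latticeValue_add (P Q : ℤ × ℤ) :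
    latticeValue k β (P + Q) = latticeValue k β P + latticeValue k β Q := by
  simp only [latticeValue, Prod.fst_add, Prod.snd_add]
  push_cast
  ring

theorem mem_range_latticeValue_base_mul (h : IsQuadraticBase k β) {y : ℝ}
    (hy : y ∈ Set.range (latticeValue k β)) : β * y ∈ Set.range (latticeValue k β) := by
  obtain ⟨P, rfl⟩ := hy
  exact ⟨latticeStep k P 0, by simp [h.latticeValue_step]⟩

theorem mem_range_latticeValue_sub_base_pow_mul (h : IsQuadraticBase k β) {y : ℝ}
    (hy : y ∈ Set.range (latticeValue k β)) (n j : ℕ) :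
    y - β ^ n * j ∈ Set.range (latticeValue k β) := by
  have hpow : ∀ n : ℕ, β ^ n * (-j : ℝ) ∈ Set.range (latticeValue k β) := by
    intro n
    induction n with
    | zero => exact ⟨(-j, 0), by simp [latticeValue]⟩
    | succ n ih =>
      rw [pow_succ', mul_assoc]
      exact h.mem_range_latticeValue_base_mul ih
  obtain ⟨P, rfl⟩ := hy
  obtain ⟨Q, hQ⟩ := hpow n
  exact ⟨P + Q, by rw [latticeValue_add, hQ]; ring⟩

theorem mem_range_latticeValue_digitRemainder (h : IsQuadraticBase k β) {n : ℕ} :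
    ∀ {y : ℝ} (ε : ℕ → Fin (2 * k + 1 + 1)), β ^ n * y ∈ Set.range (latticeValue k β) →
      digitRemainder β ε y n ∈ Set.range (latticeValue k β) := by
  induction n with
  | zero => simp [digitRemainder]
  | succ n ih =>
    intro y ε hy
    rw [Nat.add_comm n 1, digitRemainder_add]
    refine ih _ ?_
    simp only [digitRemainder]
    have := h.mem_range_latticeValue_sub_base_pow_mul hy n (ε 0)
    rwa [pow_succ, mul_assoc, ← mul_sub] at this

/-- Since β²/(k+1) = β+1, the factor β^(2n) clears the denominator. -/
theorem mem_range_latticeValue_pow_mul_div (h : IsQuadraticBase k β) (n : ℕ) (p q : ℤ) :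
    β ^ (2 * n) * ((p * β + q) / ((k : ℝ) + 1) ^ n) ∈ Set.range (latticeValue k β) := by
  have hk : ((k : ℝ) + 1) ≠ 0 := by positivity
  have e : β ^ (2 * n) * ((p * β + q) / ((k : ℝ) + 1) ^ n) = (β + 1) ^ n * (p * β + q) := by
    rw [pow_mul, h.sq, mul_pow]
    field_simp
  rw [e]
  clear e
  induction n with
  | zero => simpa using mem_range_latticeValue_mul_add k β p q
  | succ n ih =>
    obtain ⟨P, hP⟩ := h.mem_range_latticeValue_base_mul ih
    obtain ⟨Q, hQ⟩ := ih
    exact ⟨P + Q, by rw [latticeValue_add, hP, hQ]; ring⟩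

theorem exists_nat_pow_of_zpow (k : ℕ) (β : ℝ) (n p q : ℤ) :
    ∃ (l : ℕ) (r s : ℤ), (p * β + q) / ((k : ℝ) + 1) ^ n = (r * β + s) / ((k : ℝ) + 1) ^ l := by
  have hk : ((k : ℝ) + 1) ≠ 0 := by positivity
  obtain ⟨l, rfl | rfl⟩ := n.eq_nat_or_neg
  · exact ⟨l, p, q, by rw [zpow_natCast]⟩
  · refine ⟨0, p * (k + 1) ^ l, q * (k + 1) ^ l, ?_⟩
    rw [zpow_neg, zpow_natCast, div_inv_eq_mul]
    push_cast
    ring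

theorem countable_betaExpansions (h : IsQuadraticBase k β) (n : ℕ) (p q : ℤ) :
    (betaExpansions β (2 * k + 1) ((p * β + q) / ((k : ℝ) + 1) ^ n)).Countable := by
  refine (countable_setOf_eventually_periodic_two (Fin (2 * k + 1 + 1))).mono fun ε hε => ?_
  rw [h.mem_betaExpansions_iff] at hε
  obtain ⟨P, hP⟩ := h.mem_range_latticeValue_digitRemainder ε (h.mem_range_latticeValue_pow_mul_div n p q)
  set x := ((p : ℝ) * β + q) / ((k : ℝ) + 1) ^ n
  have hdig : ∀ l, ((ε (2 * n + l) : ℕ)) ≤ 2 * k + 1 := fun l => by omega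
  have hval : ∀ l, latticeValue k β (latticeOrbit k (fun l => (ε (2 * n + l) : ℕ)) P l) =
      digitRemainder β ε x (2 * n + l) := by
    intro l
    induction l with
    | zero => exact hP
    | succ l ih => rw [latticeOrbit, h.latticeValue_step, ih, ← Nat.add_assoc, digitRemainder]
  obtain ⟨N, hN⟩ := h.exists_forall_ge_abs_latticeConj_lt hdig P
  obtain ⟨M, hM⟩ := eventually_periodic_of_isRecurrentPoint hdig fun l hl =>
    h.isRecurrentPoint_of_conj_lt (by rw [hval]; exact hε _) (hN l hl)
  refine ⟨2 * n + M, fun i hi => ?_⟩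
  obtain ⟨l, rfl⟩ := Nat.exists_eq_add_of_le hi
  have := hM (M + l) (by omega)
  rw [← Nat.add_assoc, ← Nat.add_assoc] at this
  exact Fin.ext this

/-- Since 1/β = (β-k-1)/(k+1), numbers of this form are stable under y ↦ (y+j)/β. -/
theorem exists_eq_div_of_digitRemainder (h : IsQuadraticBase k β) {x : ℝ}
    {ε : ℕ → Fin (2 * k + 1 + 1)} {i : ℕ}
    (hi : ∃ (n : ℕ) (p q : ℤ), digitRemainder β ε x i = (p * β + q) / ((k : ℝ) + 1) ^ n) :
    ∃ (n : ℕ) (p q : ℤ), x = (p * β + q) / ((k : ℝ) + 1) ^ n := by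
  induction i with
  | zero => exact hi
  | succ i ih =>
    apply ih
    obtain ⟨n, p, q, e⟩ := hi
    have hk : ((k : ℝ) + 1) ≠ 0 := by positivity
    have hβ := h.pos.ne'
    set j : ℤ := ((ε i : ℕ) : ℤ) with hj
    have hj' : ((ε i : ℕ) : ℝ) = (j : ℝ) := by simp [hj]
    refine ⟨n + 1, q + j * (k + 1) ^ n, (p - q - j * (k + 1) ^ n) * (k + 1), ?_⟩
    rw [digitRemainder, hj', sub_eq_iff_eq_add] at e
    apply mul_left_cancel₀ hβ
    rw [e]
    push_cast
    field_simp
    linear_combination (-(q + j * ((k : ℝ) + 1) ^ n)) * ((k : ℝ) + 1) ^ n * h.sq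

theorem digitRemainder_mem_Ioo (h : IsQuadraticBase k β) {x : ℝ}
    (hx : ¬ ∃ (n : ℕ) (p q : ℤ), x = (p * β + q) / ((k : ℝ) + 1) ^ n)
    {ε : ℕ → Fin (2 * k + 1 + 1)} (hε : ε ∈ betaExpansions β (2 * k + 1) x) (i : ℕ) :
    digitRemainder β ε x i ∈ Set.Ioo 0 (β - k) := by
  obtain ⟨h0, h1⟩ := h.mem_betaExpansions_iff.1 hε i
  -- Both endpoints 0 and β-k have the excluded form, so reaching one would put x in that form.
  refine ⟨lt_of_le_of_ne h0 fun e => hx ?_, lt_of_le_of_ne h1 fun e => hx ?_⟩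
  · exact h.exists_eq_div_of_digitRemainder (i := i) (ε := ε) ⟨0, 0, 0, by rw [← e]; simp⟩
  · refine h.exists_eq_div_of_digitRemainder (i := i) (ε := ε) ⟨0, 1, -k, ?_⟩
    rw [e]
    push_cast
    ring

end IsQuadraticBase

/-! ### The generalized golden ratio and the conclusion -/

theorem generalizedGoldenRatio_odd (k : ℕ) :
    generalizedGoldenRatio (2 * k + 1) =
      ((k : ℝ) + 1 + Real.sqrt ((k : ℝ) ^ 2 + 6 * k + 5)) / 2 := by
  have h1 : ¬ Even (2 * k + 1) := by simp
  have h2 : (2 * k + 1) / 2 = k := by omega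
  simp only [generalizedGoldenRatio, if_neg h1, h2]

theorem isQuadraticBase_generalizedGoldenRatio (k : ℕ) :
    IsQuadraticBase k (generalizedGoldenRatio (2 * k + 1)) := by
  rw [generalizedGoldenRatio_odd]
  have h := Real.sq_sqrt (show 0 ≤ (k : ℝ) ^ 2 + 6 * k + 5 by positivity)
  exact ⟨by positivity, by linear_combination h / 4⟩

theorem theorem2 (k m : ℕ) (hm : m = 2 * k + 1) (β : ℝ) (hβ : β = generalizedGoldenRatio m) :
    β = ((k : ℝ) + 1 + Real.sqrt ((k : ℝ) ^ 2 + 6 * k + 5)) / 2 ∧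
    (m : ℝ) / (β - 1) = β - k ∧
    (∀ x ∈ countableExpansionPoints k,
      Cardinal.mk (betaExpansions β m x) = Cardinal.aleph0) ∧
    (∀ x ∈ Set.Ioo (0 : ℝ) (β - k), x ∉ countableExpansionPoints k →
      Cardinal.mk (betaExpansions β m x) = Cardinal.continuum) := by
  subst hm
  have h : IsQuadraticBase k β := hβ ▸ isQuadraticBase_generalizedGoldenRatio k
  refine ⟨hβ.trans (generalizedGoldenRatio_odd k), h.div_eq, ?_, ?_⟩
  · rintro x ⟨hx, n, p, q, e⟩
    rw [← hβ] at hx e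
    rw [h.div_eq] at hx
    obtain ⟨l, r, s, e'⟩ := IsQuadraticBase.exists_nat_pow_of_zpow k β n p q
    have hinf := h.infinite_betaExpansions hx
    have hcount := h.countable_betaExpansions l r s
    rw [← e', ← e] at hcount
    have := hcount.to_subtype
    have := hinf.to_subtype
    exact Cardinal.mk_eq_aleph0 _
  · intro x hx hnot
    refine h.mk_betaExpansions_eq_continuum hx fun ε hε => h.digitRemainder_mem_Ioo ?_ hε
    rintro ⟨n, p, q, e⟩
    refine hnot ⟨?_, n, p, q, ?_⟩
    · rw [← hβ, h.div_eq]
      exact hx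
    · rw [← hβ, zpow_natCast]
      exact e
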